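/- For every real $c>0$ and every integer $d\ge 1$ there exist $\epsilon_0>0$ and $N$, depending only on $c$ and $d$, such that the following holds for all $n\ge N$. Let $\alpha\in\mathbb{Z}_{2^n-1}$, identified with its representative in $\{0,1,\dots,2^n-2\}$, and suppose that the $n$-bit base $2$ representation of $\alpha$ (leading zeros included) has the form $\sigma_1\sigma_2\cdots\sigma_m$ with $m\ge cn$, where each $\sigma_i$ is a nonempty block $0^{L_i}$ or $1^{L_i}$ and each $L_i$ is maximal (that is, neighbouring blocks consist of different bits). Define $\Lambda:\mathbb{F}_{2^n}\to\mathbb{F}_{2^n}$ by $\Lambda(x)=x^{\alpha}$. Identify $\mathbb{F}_{2^n}$ with $\mathbb{F}_2^n$ by means of any basis over $\mathbb{F}_2$. Then for every $\mathrm{AC}^0(\oplus)$ circuit $C:\mathbb{F}_{2^n}\to\mathbb{F}_{2^n}$ of depth at most $d$ and size at most $2^{n^{1/(5d)}}$, $$\Pr_{x\in\mathbb{F}_{2^n}}[C(x)=\Lambda(x)]\le 1-\epsilon_0,$$ where $x$ is uniformly distributed. Here an $\mathrm{AC}^0(\oplus)$ circuit is an arithmetic circuit over $\mathbb{F}_2$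 with $n$ input variables and $n$ outputs, built from addition and multiplication gates of unbounded fan-in; the constants of $\mathbb{F}_2$ are available as leaves, the size is the number of gates, and the depth is the largest number of gates on a path from a leaf to an output. -/

import Mathlib

/-- The `n`-bit base 2 representation of `a`, most significant bit first
(`a < 2 ^ n` in all uses). -/
def binaryString (n a : ℕ) : List Bool :=
  List.ofFn fun i : Fin n => a.testBit (Fin.rev i : Fin n)

/-- `IsBlockForm σ B`: the bit-string `σ` is the concatenation `σ₁ σ₂ ⋯ σ_m` of the blocks listed
in `B`, where the entry `(L, b)` of `B` stands for the block `b ^ L`.  The blocks are nonempty, and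
they are maximal: neighbouring blocks consist of different bits. -/
def IsBlockForm (σ : List Bool) (B : List (ℕ × Bool)) : Prop :=
  σ = (B.map fun p => List.replicate p.1 p.2).flatten ∧
    (∀ p ∈ B, 0 < p.1) ∧ B.IsChain fun p q => p.2 ≠ q.2

namespace ArithCircuit

/-- What can be fed into a gate, or be an output, of a circuit over `𝔽₂` with `n` input variables
and `k` gates available so far: a variable, a field constant, or one of those gates. -/
inductive Wire (n k : ℕ) : Type
  | var (i : Fin n) : Wire n k
  | const (a : ZMod 2) : Wire n k
  | gate (j : Fin k) : Wire n k

/-- A gate of unbounded fan-in: addition or multiplication over `𝔽₂` of any list of wires. -/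
inductive Gate (n k : ℕ) : Type
  | add (args : List (Wire n k)) : Gate n k
  | mul (args : List (Wire n k)) : Gate n k

/-- A sequence of `k` gates in topological order: each gate may use all gates before it, any number
of times (so the underlying graph is an arbitrary finite directed acyclic graph). -/
inductive Gates (n : ℕ) : ℕ → Type
  | nil : Gates n 0
  | snoc {k : ℕ} (gs : Gates n k) (g : Gate n k) : Gates n (k + 1)

variable {n k : ℕ}

/-- The value of a wire, given the values `x` of the variables and `v` of the gates. -/
def Wire.eval (x : Fin n → ZMod 2) (v : Fin k → ZMod 2) : Wire n k → ZMod 2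
  | .var i => x i
  | .const a => a
  | .gate j => v j

/-- The value computed by a gate. -/
def Gate.eval (x : Fin n → ZMod 2) (v : Fin k → ZMod 2) : Gate n k → ZMod 2
  | .add args => (args.map (Wire.eval x v)).sum
  | .mul args => (args.map (Wire.eval x v)).prod

/-- The values of all gates. -/
def Gates.eval (x : Fin n → ZMod 2) : {k : ℕ} → Gates n k → Fin k → ZMod 2
  | _, .nil => Fin.elim0
  | _, .snoc gs g => Fin.snoc (α := fun _ => ZMod 2) (gs.eval x) (g.eval x (gs.eval x))

/-- The depth of a wire, given the depths `δ` of the gates; variables and constants have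
depth `0`. -/
def Wire.depth (δ : Fin k → ℕ) : Wire n k → ℕ
  | .var _ => 0
  | .const _ => 0
  | .gate j => δ j

/-- The depth of a gate: one more than the largest depth of a wire that is fed into it. -/
def Gate.depth (δ : Fin k → ℕ) : Gate n k → ℕ
  | .add args => (args.map (Wire.depth δ)).foldr max 0 + 1
  | .mul args => (args.map (Wire.depth δ)).foldr max 0 + 1

/-- The depths of all gates. -/
def Gates.depth : {k : ℕ} → Gates n k → Fin k → ℕ
  | _, .nil => Fin.elim0
  | _, .snoc gs g => Fin.snoc (α := fun _ => ℕ) gs.depth (g.depth gs.depth)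

end ArithCircuit

/-- An arithmetic circuit over `𝔽₂` (an `AC⁰(⊕)` circuit, when the depth is bounded) with `n`
variables and `m` outputs, built from addition and multiplication gates of unbounded fan-in. -/
structure ArithCircuit (n m : ℕ) : Type where
  /-- The size of the circuit: its number of gates. -/
  size : ℕ
  /-- The gates, in topological order. -/
  gates : ArithCircuit.Gates n size
  /-- The output wires. -/
  output : Fin m → ArithCircuit.Wire n size

namespace ArithCircuit

variable {n m : ℕ}

/-- The function `𝔽₂ⁿ → 𝔽₂ᵐ` computed by the circuit. -/
def eval (C : ArithCircuit n m) (x : Fin n → ZMod 2) : Fin m → ZMod 2 :=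
  fun i => (C.output i).eval x (C.gates.eval x)

/-- The depth of the circuit: the largest number of gates on a path from a leaf to an output. -/
def depth (C : ArithCircuit n m) : ℕ :=
  Finset.univ.sup fun i => (C.output i).depth C.gates.depth

/-- The function `𝔽_{2ⁿ} → 𝔽_{2ⁿ}` computed by the circuit when the elements of `𝔽_{2ⁿ}` are
written in coordinates with respect to the `𝔽₂`-basis `b`. -/
noncomputable def evalField (C : ArithCircuit n n)
    (b : Module.Basis (Fin n) (ZMod 2) (GaloisField 2 n)) (x : GaloisField 2 n) :
    GaloisField 2 n :=
  b.equivFun.symm (C.eval (b.equivFun x))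

end ArithCircuit

/-! The argument is that of Razborov and Smolensky. Replacing every product gate by a product of `l`
random-like affine combinations approximates a circuit of depth at most `d` by an `n`-tuple of
polynomials of degree at most `D = l ^ d`, wrong on a fraction at most `size / 2 ^ l` of the inputs
(`ArithCircuit.exists_approx`). With `l` about `n ^ (1 / (5 d))` this degree is about `n ^ (1 / 5)`,
far below `√n`.

Over `K = 𝔽_{2ⁿ}` Frobenius is linear, so `x ^ e` has degree at most the binary weight of `e`, and
counting dimensions shows that the powers of weight at most `r` span all polynomials of degree at
most `r` (`span_powerFunction`). Suppose that `P` of degree `D` agrees with `x ^ α` on `S`. If `e ≡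
y + α` modulo `2 ^ n - 1`, then on `S` the power `x ^ e` equals `x ^ y * P`, of degree at most `wt y
+ D`. Whenever `wt e > wt y + D`, the power `x ^ e` is thus redundant on `S`, and the remaining
powers still span the functions on `S`; hence `#S` is at most `2 ^ n` minus the number of such `e`
(`card_agree_add_card_le`).

It remains to see that cyclic addition of `α` raises the weight by more than a small multiple of
`√n` for a constant fraction of `y` (`exists_card_weightDiff_ge`). The weight difference `W` has
mean zero and fourth moment `O(n ^ 2)`, since `y` and `y + α` are each uniform. Its second moment is
at least a constant times `n`: each boundary between runs of `α` gives a local test function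
correlated with `W`, and these are nearly orthogonal. The three moments together force `W` to be
large and positive with constant probability. -/

section Powering

open Finset

/-! ### Moments of the size of a random subset -/

theorem sum_powerset_sq (s : Finset ℕ) :
    ∑ Z ∈ s.powerset, (2 * (#Z : ℝ) - #s) ^ 2 = (2 : ℝ) ^ #s * #s := by
  induction s using Finset.induction_on with
  | empty => simp
  | insert a s ha ih =>
    have h1 : ∑ Z ∈ s.powerset, (1 : ℝ) = 2 ^ #s := by simp
    rw [sum_powerset_insert ha, ← sum_add_distrib, card_insert_of_notMem ha]
    have : ∀ Z ∈ s.powerset, (2 * (#Z : ℝ) - ((#s + 1 : ℕ) : ℝ)) ^ 2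
        + (2 * (#(insert a Z) : ℝ) - ((#s + 1 : ℕ) : ℝ)) ^ 2
        = 2 * (2 * (#Z : ℝ) - #s) ^ 2 + 2 * 1 := by
      intro Z hZ
      rw [card_insert_of_notMem fun h => ha (mem_powerset.1 hZ h)]
      push_cast; ring
    rw [sum_congr rfl this, sum_add_distrib, ← mul_sum, ← mul_sum, ih, h1]
    push_cast; ring

theorem sum_powerset_pow_four (s : Finset ℕ) :
    ∑ Z ∈ s.powerset, (2 * (#Z : ℝ) - #s) ^ 4 = 2 ^ #s * (3 * (#s : ℝ) ^ 2 - 2 * #s) := by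
  induction s using Finset.induction_on with
  | empty => simp
  | insert a s ha ih =>
    have h1 : ∑ Z ∈ s.powerset, (1 : ℝ) = 2 ^ #s := by simp
    rw [sum_powerset_insert ha, ← sum_add_distrib, card_insert_of_notMem ha]
    have : ∀ Z ∈ s.powerset, (2 * (#Z : ℝ) - ((#s + 1 : ℕ) : ℝ)) ^ 4
        + (2 * (#(insert a Z) : ℝ) - ((#s + 1 : ℕ) : ℝ)) ^ 4
        = 2 * (2 * (#Z : ℝ) - #s) ^ 4 + 12 * (2 * (#Z : ℝ) - #s) ^ 2 + 2 * 1 := by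
      intro Z hZ
      rw [card_insert_of_notMem fun h => ha (mem_powerset.1 hZ h)]
      push_cast; ring
    rw [sum_congr rfl this, sum_add_distrib, sum_add_distrib, ← mul_sum, ← mul_sum, ← mul_sum, ih,
      sum_powerset_sq, h1]
    push_cast; ring

/-! ### Carries in a cyclic binary addition

Let `a` be the sequence of digits of a number `α`, and let `y` be a number whose digit agrees with
that of `α` exactly at the positions in `Z ∪ {0}`. In the addition `y + α` the carry into position
`i + 1` is `a i` if `i ∈ Z ∪ {0}` and equals the carry into position `i` otherwise. -/

/-- The carry into position `i` of `y + α`, for `1 ≤ i`. -/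
def carry (a : ℕ → Bool) (Z : Finset ℕ) : ℕ → Bool
  | 0 => a 0
  | i + 1 => if i ∈ Z then a i else carry a Z i

/-- The positive positions below `n` of the digits `1` of `y`. -/
def addend (a : ℕ → Bool) (n : ℕ) (Z : Finset ℕ) : Finset ℕ :=
  {i ∈ Ico 1 n | a i = decide (i ∈ Z)}

/-- The positive positions below `n` of the digits `1` of `y + α`. -/
def total (a : ℕ → Bool) (n : ℕ) (Z : Finset ℕ) : Finset ℕ :=
  {i ∈ Ico 1 n | carry a Z i = decide (i ∈ Z)}

theorem addend_subset (a : ℕ → Bool) (n : ℕ) (Z : Finset ℕ) : addend a n Z ⊆ Ico 1 n :=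
  filter_subset _ _

theorem total_subset (a : ℕ → Bool) (n : ℕ) (Z : Finset ℕ) : total a n Z ⊆ Ico 1 n :=
  filter_subset _ _

theorem carry_congr (a : ℕ → Bool) {Z Z' : Finset ℕ} {i : ℕ} (h : ∀ j < i, j ∈ Z ↔ j ∈ Z') :
    carry a Z i = carry a Z' i := by
  induction i with
  | zero => rfl
  | succ i ih =>
    simp only [carry, h i (Nat.lt_succ_self i), ih fun j hj => h j (hj.trans (Nat.lt_succ_self i))]

/-! ### Uniformity of the summand and of the sum, and moment bounds -/

theorem injOn_addend (a : ℕ → Bool) (n : ℕ) :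
    Set.InjOn (addend a n) ((Ico 1 n).powerset : Finset (Finset ℕ)) := by
  intro Z hZ Z' hZ' h
  simp only [coe_powerset, Set.mem_preimage, Set.mem_powerset_iff, coe_subset] at hZ hZ'
  ext i
  by_cases hi : i ∈ Ico 1 n
  · have := congrArg (i ∈ ·) h
    simp only [addend, mem_filter, hi, true_and, eq_iff_iff] at this
    by_cases h1 : i ∈ Z <;> by_cases h2 : i ∈ Z' <;> cases hh : a i <;> simp_all
  · exact ⟨fun h => absurd (hZ h) hi, fun h => absurd (hZ' h) hi⟩

/-- The carry into position `i` depends only on the part of `Z` below `i`, so `Z` can be decoded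
from the digits of the sum, starting at the lowest. -/
theorem injOn_total (a : ℕ → Bool) (n : ℕ) :
    Set.InjOn (total a n) ((Ico 1 n).powerset : Finset (Finset ℕ)) := by
  intro Z hZ Z' hZ' h
  simp only [coe_powerset, Set.mem_preimage, Set.mem_powerset_iff, coe_subset] at hZ hZ'
  ext i
  induction i using Nat.strong_induction_on with
  | _ i ih =>
    by_cases hi : i ∈ Ico 1 n
    · have := congrArg (i ∈ ·) h
      simp only [total, mem_filter, hi, true_and, eq_iff_iff, carry_congr a ih] at this
      by_cases h1 : i ∈ Z <;> by_cases h2 : i ∈ Z' <;> cases hh : carry a Z' i <;> simp_all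
    · exact ⟨fun h => absurd (hZ h) hi, fun h => absurd (hZ' h) hi⟩

theorem sum_powerset_comp {s : Finset ℕ} {f : Finset ℕ → Finset ℕ} (hf : ∀ Z, f Z ⊆ s)
    (hinj : Set.InjOn f (s.powerset : Finset (Finset ℕ))) (g : Finset ℕ → ℝ) :
    ∑ Z ∈ s.powerset, g (f Z) = ∑ Z ∈ s.powerset, g Z := by
  have himg : s.powerset.image f = s.powerset :=
    eq_of_subset_of_card_le (by intro Z; simp only [mem_image, mem_powerset]
                                rintro ⟨Y, -, rfl⟩; exact hf Y)
      (card_image_of_injOn hinj).ge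
  conv_rhs => rw [← himg]
  rw [sum_image hinj]

/-- The difference of the numbers of digits `1` of `y + α` and of `y`, in positive positions. -/
def weightDiff (a : ℕ → Bool) (n : ℕ) (Z : Finset ℕ) : ℝ :=
  (#(total a n Z) : ℝ) - #(addend a n Z)

/-- The two weights are far from independent, but both maps permute the subsets of `Ico 1 n`, so
they have the same distribution. -/
theorem sum_weightDiff (a : ℕ → Bool) (n : ℕ) :
    ∑ Z ∈ (Ico 1 n).powerset, weightDiff a n Z = 0 := by
  simp only [weightDiff, sum_sub_distrib]
  rw [sum_powerset_comp (total_subset a n) (injOn_total a n) fun Z => (#Z : ℝ),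
    sum_powerset_comp (addend_subset a n) (injOn_addend a n) fun Z => (#Z : ℝ), sub_self]

theorem sum_weightDiff_pow_four_le (a : ℕ → Bool) {n : ℕ} (hn : 1 ≤ n) :
    ∑ Z ∈ (Ico 1 n).powerset, weightDiff a n Z ^ 4 ≤ 3 * (n : ℝ) ^ 2 * 2 ^ (n - 1) := by
  have hk : #(Ico 1 n) = n - 1 := by simp
  -- Convexity of the fourth power, centred at `w / 2`: it bounds the moment of the difference by
  -- the moments of two uniform weights, whatever their joint law.
  have key : ∀ u v w : ℝ, (u - v) ^ 4 ≤ ((2 * u - w) ^ 4 + (2 * v - w) ^ 4) / 2 := by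
    intro u v w
    nlinarith [sq_nonneg ((2 * u - w) ^ 2 - (2 * v - w) ^ 2), sq_nonneg ((2 * u - w) + (2 * v - w)),
      sq_nonneg ((2 * u - w) - (2 * v - w)), mul_nonneg (sq_nonneg ((2 * u - w) + (2 * v - w)))
        (sq_nonneg ((2 * u - w) - (2 * v - w))), sq_nonneg (((2 * u - w) + (2 * v - w)) ^ 2)]
  calc ∑ Z ∈ (Ico 1 n).powerset, weightDiff a n Z ^ 4
      ≤ ∑ Z ∈ (Ico 1 n).powerset, ((2 * (#(total a n Z) : ℝ) - #(Ico 1 n)) ^ 4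
          + (2 * (#(addend a n Z) : ℝ) - #(Ico 1 n)) ^ 4) / 2 :=
        sum_le_sum fun Z _ => key _ _ _
    _ = 2 ^ (n - 1) * (3 * ((n - 1 : ℕ) : ℝ) ^ 2 - 2 * ((n - 1 : ℕ) : ℝ)) := by
        rw [← sum_div, sum_add_distrib,
          sum_powerset_comp (total_subset a n) (injOn_total a n)
            fun Z => (2 * (#Z : ℝ) - #(Ico 1 n)) ^ 4,
          sum_powerset_comp (addend_subset a n) (injOn_addend a n)
            fun Z => (2 * (#Z : ℝ) - #(Ico 1 n)) ^ 4, sum_powerset_pow_four, hk]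
        ring
    _ ≤ _ := by
        rw [mul_comm]
        gcongr
        rw [Nat.cast_sub hn]
        have : (1 : ℝ) ≤ n := by exact_mod_cast hn
        push_cast
        nlinarith

/-! ### Lower bound for the second moment -/

/-- At each position the full adder gives: digit of `y` + digit of `α` + carry in = digit of the sum
+ twice the carry out. -/
theorem weightDiff_eq_sum (a : ℕ → Bool) (n : ℕ) (Z : Finset ℕ) :
    weightDiff a n Z = ∑ i ∈ Ico 1 n, (((a i).toNat : ℝ) + (carry a Z i).toNat
      - 2 * (carry a Z (i + 1)).toNat) := by
  simp only [weightDiff, total, addend, card_filter]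
  push_cast
  rw [← sum_sub_distrib]
  refine sum_congr rfl fun i _ => ?_
  simp only [carry]
  by_cases h : i ∈ Z <;> cases a i <;> cases carry a Z i <;> simp [h] <;> norm_num

/-- Inserting `j` into `Z` when both its neighbours are in `Z` only changes the carry into
position `j + 1`. -/
theorem carry_insert (a : ℕ → Bool) {j : ℕ} {Z : Finset ℕ} (hp : j + 2 ∈ Z) (i : ℕ)
    (hi : i ≠ j + 2) : carry a (insert (j + 1) Z) i = carry a Z i := by
  rcases lt_or_gt_of_ne hi with h | h
  · exact carry_congr a fun l hl => by simp [show l ≠ j + 1 by omega]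
  · obtain ⟨m, rfl⟩ := Nat.exists_eq_add_of_lt h
    induction m with
    | zero => simp [carry, hp]
    | succ m ih =>
      have := ih (by omega) (by omega)
      rw [show j + 2 + (m + 1) + 1 = (j + 2 + m + 1) + 1 by ring]
      simp only [carry.eq_2 a _ (j + 2 + m + 1), this]
      simp [show j + 2 + m ≠ j by omega]

/-- Only the carry into `j + 2` changes, from `a j` to `a (j + 1)`. It enters with coefficient `-2`
as the carry out of `j + 1` and with `+1` as the carry into `j + 2`, so with `-1` in total. -/
theorem weightDiff_insert (a : ℕ → Bool) {n j : ℕ} {Z : Finset ℕ} (hjn : j + 2 < n)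
    (hm : j ∈ Z) (hj : j + 1 ∉ Z) (hp : j + 2 ∈ Z) :
    weightDiff a n (insert (j + 1) Z) - weightDiff a n Z
      = ((a j).toNat : ℝ) - (a (j + 1)).toNat := by
  rw [weightDiff_eq_sum, weightDiff_eq_sum, ← sum_sub_distrib]
  have h1 : carry a (insert (j + 1) Z) (j + 2) = a (j + 1) := by simp [carry]
  have h2 : carry a Z (j + 2) = a j := by simp [carry, hm, hj]
  have hsub : ({j + 1, j + 2} : Finset ℕ) ⊆ Ico 1 n := by
    intro i; simp only [mem_insert, mem_singleton, mem_Ico]; omega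
  rw [← sum_subset hsub, sum_pair (by omega), show j + 1 + 1 = j + 2 from rfl, h1, h2,
    carry_insert a hp (j + 1) (by omega), carry_insert a hp (j + 2 + 1) (by omega)]
  · ring
  · intro i _ hi
    simp only [mem_insert, mem_singleton, not_or] at hi
    rw [carry_insert a hp i hi.2, carry_insert a hp (i + 1) (by omega)]
    ring

/-- A test function that is correlated with `weightDiff`. -/
def probe (j : ℕ) (Z : Finset ℕ) : ℝ :=
  if j ∈ Z ∧ j + 2 ∈ Z then if j + 1 ∈ Z then 1 else -1 else 0

theorem abs_probe_le (j : ℕ) (Z : Finset ℕ) : |probe j Z| ≤ 1 := by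
  unfold probe; split_ifs <;> simp

/-- Pairing `Z` with `insert (j + 1) Z` turns the correlation into a sum of discrete derivatives of
`weightDiff`, constant by `weightDiff_insert`, over the `2 ^ (n - 4)` sets that contain both
neighbours. It is nonzero exactly when `j` is a run boundary. -/
theorem sum_weightDiff_mul_probe (a : ℕ → Bool) {n j : ℕ} (hj : 1 ≤ j) (hjn : j + 2 < n) :
    ∑ Z ∈ (Ico 1 n).powerset, weightDiff a n Z * probe j Z
      = (((a j).toNat : ℝ) - (a (j + 1)).toNat) * 2 ^ (n - 4) := by
  have hI : Ico 1 n = insert (j + 1) ((Ico 1 n).erase (j + 1)) :=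
    (insert_erase (by simp; omega)).symm
  set I := (Ico 1 n).erase (j + 1) with hIdef
  have hcard : #I = n - 2 := by
    rw [card_erase_of_mem (by simp; omega)]; simp; omega
  have hsub : ({j, j + 2} : Finset ℕ) ⊆ I := by
    intro i; simp only [mem_insert, mem_singleton, mem_Ico, I, mem_erase]; omega
  have hcount : ∑ Z ∈ I.powerset, (if j ∈ Z ∧ j + 2 ∈ Z then (1 : ℝ) else 0) = 2 ^ (n - 4) := by
    have h := card_Icc_finset hsub
    rw [card_pair (by omega), hcard, show n - 2 - 2 = n - 4 by omega] at h
    rw [sum_boole]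
    have : {Z ∈ I.powerset | j ∈ Z ∧ j + 2 ∈ Z} = Icc {j, j + 2} I := by
      ext Z
      simp only [mem_filter, mem_powerset, mem_Icc, insert_subset_iff,
        singleton_subset_iff]
      tauto
    rw [this, h]; push_cast; rfl
  rw [show (Ico 1 n).powerset = (insert (j + 1) I).powerset by rw [← hI],
    sum_powerset_insert (notMem_erase _ _), ← sum_add_distrib, ← hcount, mul_sum]
  refine sum_congr rfl fun Z hZ => ?_
  have hjZ : j + 1 ∉ Z := fun h => notMem_erase _ _ (mem_powerset.1 hZ h)
  by_cases h : j ∈ Z ∧ j + 2 ∈ Z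
  · rw [← weightDiff_insert a hjn h.1 hjZ h.2]
    simp [probe, h, hjZ]; ring
  · have : ¬ (j ∈ insert (j + 1) Z ∧ j + 2 ∈ insert (j + 1) Z) := by simpa using h
    rw [probe, probe, if_neg h, if_neg this, if_neg h]; ring

/-- Toggling `j + 1` flips the sign of `probe j` and leaves `probe l` alone, because `probe l` only
looks at `l`, `l + 1` and `l + 2`. -/
theorem sum_probe_mul_probe {n j l : ℕ} (hjn : j + 1 ∈ Ico 1 n) (h1 : j ≠ l) (h2 : j + 1 ≠ l)
    (h3 : j ≠ l + 1) : ∑ Z ∈ (Ico 1 n).powerset, probe j Z * probe l Z = 0 := by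
  have hI := (insert_erase hjn).symm
  set I := (Ico 1 n).erase (j + 1)
  rw [hI, sum_powerset_insert (notMem_erase _ _), ← sum_add_distrib]
  refine sum_eq_zero fun Z hZ => ?_
  have hjZ : j + 1 ∉ Z := fun h => notMem_erase _ _ (mem_powerset.1 hZ h)
  have hl : probe l (insert (j + 1) Z) = probe l Z := by
    simp only [probe, mem_insert, show l ≠ j + 1 by omega, show l + 1 ≠ j + 1 by omega,
      show l + 2 ≠ j + 1 by omega, false_or]
  have hj : probe j (insert (j + 1) Z) = - probe j Z := by
    by_cases h : j ∈ Z ∧ j + 2 ∈ Z <;> simp [probe, h, hjZ]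
  rw [hl, hj]; ring

theorem sum_sq_sum_probe_le {n : ℕ} {J : Finset ℕ} (hJ : ∀ j ∈ J, j + 1 ∈ Ico 1 n) (s : ℕ → ℝ)
    (hs : ∀ j ∈ J, |s j| ≤ 1) :
    ∑ Z ∈ (Ico 1 n).powerset, (∑ j ∈ J, s j * probe j Z) ^ 2 ≤ 3 * #J * 2 ^ (n - 1) := by
  have hb : ∀ j ∈ J, ∀ l ∈ J, ∑ Z ∈ (Ico 1 n).powerset, s j * probe j Z * (s l * probe l Z)
      ≤ if l ∈ ({j, j + 1, j - 1} : Finset ℕ) then 2 ^ (n - 1) else 0 := by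
    intro j hj l hl
    split_ifs with h
    · calc _ ≤ ∑ Z ∈ (Ico 1 n).powerset, (1 : ℝ) := by
            refine sum_le_sum fun Z _ => le_of_abs_le ?_
            rw [abs_mul, abs_mul, abs_mul]
            exact mul_le_one₀ (mul_le_one₀ (hs j hj) (abs_nonneg _) (abs_probe_le _ _))
              (by positivity) (mul_le_one₀ (hs l hl) (abs_nonneg _) (abs_probe_le _ _))
        _ = _ := by simp
    · simp only [mem_insert, mem_singleton, not_or] at h
      have := sum_probe_mul_probe (n := n) (j := j) (l := l) (hJ j hj) (by omega) (by omega)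
        (by omega)
      calc _ = ∑ Z ∈ (Ico 1 n).powerset, (s j * s l) * (probe j Z * probe l Z) :=
            sum_congr rfl fun _ _ => by ring
        _ ≤ 0 := by rw [← mul_sum, this, mul_zero]
  calc _ = ∑ j ∈ J, ∑ l ∈ J, ∑ Z ∈ (Ico 1 n).powerset, s j * probe j Z * (s l * probe l Z) := by
        simp only [sq, sum_mul_sum]
        rw [sum_comm]
        exact sum_congr rfl fun _ _ => sum_comm
    _ ≤ ∑ j ∈ J, ∑ l ∈ J, if l ∈ ({j, j + 1, j - 1} : Finset ℕ) then (2 : ℝ) ^ (n - 1) else 0 :=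
        sum_le_sum fun j hj => sum_le_sum fun l hl => hb j hj l hl
    _ ≤ ∑ j ∈ J, 3 * 2 ^ (n - 1) := by
        refine sum_le_sum fun j _ => ?_
        rw [← sum_filter, sum_const, nsmul_eq_mul]
        gcongr
        have h1 : #{l ∈ J | l ∈ ({j, j + 1, j - 1} : Finset ℕ)} ≤ #({j, j + 1, j - 1} : Finset ℕ) :=
          card_le_card fun l hl => (mem_filter.1 hl).2
        exact_mod_cast h1.trans card_le_three
    _ = _ := by simp; ring

/-- A Cauchy–Schwarz argument: the signed sum `G` of the probes has correlation `#J * 2 ^ (n - 4)`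
with `weightDiff`, while near orthogonality keeps its squared norm at most `24` times that. -/
theorem le_sum_weightDiff_sq (a : ℕ → Bool) {n : ℕ} {J : Finset ℕ}
    (hJ : ∀ j ∈ J, 1 ≤ j ∧ j + 2 < n ∧ a j ≠ a (j + 1)) :
    (#J : ℝ) / 192 * 2 ^ (n - 1) ≤ ∑ Z ∈ (Ico 1 n).powerset, weightDiff a n Z ^ 2 := by
  rcases J.eq_empty_or_nonempty with rfl | ⟨j₀, hj₀⟩
  · simp; positivity
  have hn : 4 ≤ n := by have := hJ j₀ hj₀; omega
  set s : ℕ → ℝ := fun j => ((a j).toNat : ℝ) - (a (j + 1)).toNat with hs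
  have hs1 : ∀ j ∈ J, s j ^ 2 = 1 := by
    intro j hj
    have := (hJ j hj).2.2
    simp only [hs]
    cases h1 : a j <;> cases h2 : a (j + 1) <;> simp_all
  have hG := sum_sq_sum_probe_le (n := n) (J := J)
    (fun j hj => by have := hJ j hj; simp; omega) s
    (fun j hj => by rw [← sq_le_one_iff_abs_le_one]; exact (hs1 j hj).le)
  have hWG : ∑ Z ∈ (Ico 1 n).powerset, weightDiff a n Z * ∑ j ∈ J, s j * probe j Z
      = #J * 2 ^ (n - 4) := by
    simp only [mul_sum]
    rw [sum_comm]
    calc _ = ∑ j ∈ J, s j * ∑ Z ∈ (Ico 1 n).powerset, weightDiff a n Z * probe j Z :=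
          sum_congr rfl fun j _ => by rw [mul_sum]; exact sum_congr rfl fun _ _ => by ring
      _ = ∑ j ∈ J, (2 : ℝ) ^ (n - 4) := sum_congr rfl fun j hj => by
          rw [sum_weightDiff_mul_probe a (hJ j hj).1 (hJ j hj).2.1, ← mul_assoc, ← sq, hs1 j hj,
            one_mul]
      _ = _ := by simp
  have hp : (2 : ℝ) ^ (n - 1) = 8 * 2 ^ (n - 4) := by
    rw [show n - 1 = 3 + (n - 4) by omega, pow_add]; norm_num
  -- This is `W² ≥ 2 μ W G - μ² G²` with `μ = 1 / 24`, the best choice for the two bounds just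
  -- obtained.
  have hle : ∑ Z ∈ (Ico 1 n).powerset, (1 / 12 * (weightDiff a n Z * ∑ j ∈ J, s j * probe j Z)
      - 1 / 576 * (∑ j ∈ J, s j * probe j Z) ^ 2)
      ≤ ∑ Z ∈ (Ico 1 n).powerset, weightDiff a n Z ^ 2 :=
    sum_le_sum fun Z _ => by
      nlinarith [sq_nonneg (weightDiff a n Z - 1 / 24 * ∑ j ∈ J, s j * probe j Z)]
  rw [sum_sub_distrib, ← mul_sum, ← mul_sum, hWG] at hle
  rw [hp] at hG ⊢
  nlinarith

/-- The weight difference exceeds any fixed small multiple of `√n` with constant probability. -/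
theorem exists_card_weightDiff_ge (c : ℝ) (hc : 0 < c) :
    ∃ K > 0, ∃ δ > 0, ∀ (a : ℕ → Bool) (n : ℕ) (J : Finset ℕ) (D : ℝ), 1 ≤ n →
      (∀ j ∈ J, 1 ≤ j ∧ j + 2 < n ∧ a j ≠ a (j + 1)) → c * n ≤ #J → 0 ≤ D → D ≤ K * √n →
        δ * 2 ^ n ≤ (#{Z ∈ (Ico 1 n).powerset | D < weightDiff a n Z} : ℝ) := by
  obtain ⟨c₁, hc₁⟩ : ∃ c₁, c₁ = c / 192 := ⟨_, rfl⟩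
  have hc₁' : 0 < c₁ := by rw [hc₁]; positivity
  -- Chosen so that, at scale `s = lam * √n`, the fourth-moment term below costs half of the
  -- second-moment gain; a further quarter pays for `D`.
  set lam := √(12 / c₁) with hlam
  have hlam' : 0 < lam := by positivity
  have hlam2 : lam ^ 2 = 12 / c₁ := Real.sq_sqrt (by positivity)
  refine ⟨c₁ / (8 * lam), by positivity, c₁ ^ 2 / 384, by positivity, ?_⟩
  intro a n J D hn hJ hJc hD0 hD
  set N : ℝ := 2 ^ (n - 1) with hN
  have hNpos : 0 < N := by positivity
  have hn2 : (2 : ℝ) ^ n = 2 * N := by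
    rw [hN, ← pow_succ']; congr 1; omega
  have hnpos : (0 : ℝ) < n := by exact_mod_cast hn
  set r := √(n : ℝ) with hr
  have hrpos : 0 < r := Real.sqrt_pos.2 hnpos
  have hr2 : r ^ 2 = n := Real.sq_sqrt hnpos.le
  set s := lam * r with hs
  have hspos : 0 < s := by positivity
  have h1 := sum_weightDiff a n
  have h4 := sum_weightDiff_pow_four_le a hn
  have h2 : c₁ * n * N ≤ ∑ Z ∈ (Ico 1 n).powerset, weightDiff a n Z ^ 2 := by
    refine le_trans ?_ (le_sum_weightDiff_sq a hJ)
    gcongr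
    rw [hc₁]; linarith
  -- A polynomial minorant of the indicator of `D < w`. Its linear term has sum zero; it is there
  -- because `w / 2 + |w| / 2` is the positive part of `w`, so that large negative values do not
  -- count.
  have hpt : ∀ w : ℝ, w / 2 + (1 / (2 * s)) * w ^ 2 - 1 / s ^ 3 * w ^ 4
      ≤ D + 2 * s * (if D < w then 1 else 0) := by
    intro w
    have habs : w ^ 2 / s - w ^ 4 / s ^ 3 ≤ |w| / 2 := by
      have hw : ∀ t : ℝ, 0 ≤ t → t ^ 2 - t ^ 4 ≤ t / 2 := by
        intro t ht
        nlinarith [mul_nonneg ht (sq_nonneg (t - 1 / 2)), mul_nonneg ht (sq_nonneg (t - 1)),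
          mul_nonneg ht (mul_nonneg ht (sq_nonneg (t - 1 / 2))), mul_nonneg ht (sq_nonneg (t - 3/5))]
      have := hw (|w| / s) (by positivity)
      have e2 : |w| ^ 2 = w ^ 2 := sq_abs w
      have e4 : |w| ^ 4 = w ^ 4 := by rw [show 4 = 2 * 2 from rfl, pow_mul, pow_mul, e2]
      rw [div_pow, div_pow, e2, e4] at this
      calc w ^ 2 / s - w ^ 4 / s ^ 3 = s * (w ^ 2 / s ^ 2 - w ^ 4 / s ^ 4) := by field_simp
        _ ≤ s * (|w| / s / 2) := by gcongr
        _ = |w| / 2 := by field_simp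
    have hmax : w / 2 + |w| / 2 ≤ D + 2 * s * (if D < w then 1 else 0) + w ^ 2 / (2 * s) := by
      have hq : 0 ≤ w ^ 2 / (2 * s) := by positivity
      split_ifs with h
      · rw [abs_of_pos (hD0.trans_lt h)]
        have : w ≤ 2 * s + w ^ 2 / (2 * s) := by
          have : w ^ 2 / (2 * s) * (2 * s) = w ^ 2 := by field_simp
          by_contra! hcon
          nlinarith [sq_nonneg (w - 2 * s), mul_pos hspos hspos]
        linarith
      · rcases le_total 0 w with h0 | h0
        · rw [abs_of_nonneg h0]; linarith
        · rw [abs_of_nonpos h0]; linarith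
    have e : w ^ 2 / s = 2 * (w ^ 2 / (2 * s)) := by field_simp
    have e' : (1 / (2 * s)) * w ^ 2 = w ^ 2 / (2 * s) := by ring
    have e'' : 1 / s ^ 3 * w ^ 4 = w ^ 4 / s ^ 3 := by ring
    linarith
  have hsum := sum_le_sum fun Z (_ : Z ∈ (Ico 1 n).powerset) => hpt (weightDiff a n Z)
  rw [sum_sub_distrib, sum_add_distrib, sum_add_distrib, ← sum_div, h1, ← mul_sum, ← mul_sum,
    ← mul_sum, sum_boole, sum_const, card_powerset, Nat.card_Ico, nsmul_eq_mul, zero_div,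
    zero_add] at hsum
  set M : ℝ := (#{Z ∈ (Ico 1 n).powerset | D < weightDiff a n Z} : ℝ) with hM
  have k2 : c₁ / (2 * lam) * r * N ≤ 1 / (2 * s) * ∑ Z ∈ (Ico 1 n).powerset, weightDiff a n Z ^ 2 := by
    calc c₁ / (2 * lam) * r * N = 1 / (2 * s) * (c₁ * n * N) := by
          rw [← hr2, hs]; field_simp
      _ ≤ _ := by gcongr
  have k4 : 1 / s ^ 3 * ∑ Z ∈ (Ico 1 n).powerset, weightDiff a n Z ^ 4
      ≤ c₁ / (4 * lam) * r * N := by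
    calc _ ≤ 1 / s ^ 3 * (3 * (n : ℝ) ^ 2 * N) := by gcongr
      _ = 3 / (lam * lam ^ 2) * r * N := by rw [← hr2, hs]; field_simp
      _ = _ := by rw [hlam2]; field_simp; norm_num
  have kD : D * N ≤ c₁ / (8 * lam) * r * N := by gcongr
  push_cast at hsum
  rw [← hN] at hsum
  have hfin : c₁ / (8 * lam) * r * N ≤ 2 * s * M := by
    have e1 : c₁ / (2 * lam) = 4 * (c₁ / (8 * lam)) := by field_simp; norm_num
    have e2 : c₁ / (4 * lam) = 2 * (c₁ / (8 * lam)) := by field_simp; norm_num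
    rw [e1] at k2
    rw [e2] at k4
    linarith
  have hfin2 : 2 * s * (c₁ ^ 2 / 384 * (2 * N)) = c₁ / (8 * lam) * r * N := by
    rw [hs]
    have : lam ^ 2 * c₁ = 12 := by rw [hlam2]; field_simp
    calc _ = lam ^ 2 * c₁ * c₁ / (96 * lam) * r * N := by field_simp; norm_num
      _ = _ := by rw [this]; field_simp; norm_num
  rw [hn2]
  exact le_of_mul_le_mul_left (hfin2.trans_le hfin) (by positivity)

/-! ### From carries to addition modulo `2 ^ n - 1` -/

/-- The full adder, summed over all positions. -/
theorem sum_addend_add (a : ℕ → Bool) {n : ℕ} (hn : 1 ≤ n) (Z : Finset ℕ) :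
    ∑ i ∈ addend a n Z, 2 ^ i + ∑ i ∈ range n, 2 ^ i * (a i).toNat + (a 0).toNat
      = ∑ i ∈ total a n Z, 2 ^ i + 2 ^ n * (carry a Z n).toNat := by
  induction n, hn using Nat.le_induction with
  | base => cases h : a 0 <;> simp [addend, total, carry, h]
  | succ n hn ih =>
    simp only [addend, total, sum_filter, sum_Ico_succ_top hn, sum_range_succ] at ih ⊢
    have : (if a n = decide (n ∈ Z) then 2 ^ n else 0) + 2 ^ n * (a n).toNat
        + 2 ^ n * (carry a Z n).toNat = (if carry a Z n = decide (n ∈ Z) then 2 ^ n else 0)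
        + 2 ^ (n + 1) * (carry a Z (n + 1)).toNat := by
      simp only [carry]
      by_cases h : n ∈ Z <;> cases a n <;> cases carry a Z n <;> simp [h, pow_succ] <;> ring
    omega

theorem sum_two_pow_mul_testBit (x n : ℕ) :
    ∑ i ∈ range n, 2 ^ i * (x.testBit i).toNat = x % 2 ^ n := by
  induction n with
  | zero => simp [Nat.mod_one]
  | succ n ih => rw [sum_range_succ, ih, Nat.mod_pow_succ, Nat.toNat_testBit]

/-- Cyclic addition of `α` raises the weight by more than `D` on a constant fraction of all
bit strings, if `α` has many runs; distinct bit strings have distinct sums. -/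
theorem exists_card_cyclic_add_ge (c : ℝ) (hc : 0 < c) :
    ∃ K > 0, ∃ δ > 0, ∀ (α n : ℕ) (J : Finset ℕ) (D : ℕ), 1 ≤ n → α < 2 ^ n →
      (∀ j ∈ J, 1 ≤ j ∧ j + 2 < n ∧ α.testBit j ≠ α.testBit (j + 1)) → c * n ≤ #J →
      (D : ℝ) + 1 ≤ K * √n → ∃ E : Finset (Finset ℕ), δ * 2 ^ n ≤ (#E : ℝ) ∧ ∀ e ∈ E,
        e ⊆ range n ∧ ∃ y ⊆ range n, #y + D < #e ∧ ∃ q : ℕ,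
          ∑ i ∈ y, 2 ^ i + α = ∑ i ∈ e, 2 ^ i + (2 ^ n - 1) * q := by
  obtain ⟨K, hK, δ, hδ, h⟩ := exists_card_weightDiff_ge c hc
  refine ⟨K, hK, δ, hδ, fun α n J D hn hα hJ hJc hD => ?_⟩
  set a := α.testBit with ha
  have hsumα : ∑ i ∈ range n, 2 ^ i * (a i).toNat = α := by
    rw [sum_two_pow_mul_testBit, Nat.mod_eq_of_lt hα]
  -- The threshold is `D + 1` because the digit of `y` at position `0`, which `addend` omits, may
  -- add one to its weight.
  set S := {Z ∈ (Ico 1 n).powerset | (D : ℝ) + 1 < weightDiff a n Z} with hS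
  -- The final carry wraps around to position `0`. There the digits of `y` and `α` agree, so their
  -- sum has digit `0` and absorbs the carry without propagating it.
  set e : Finset ℕ → Finset ℕ := fun Z =>
    if carry a Z n then insert 0 (total a n Z) else total a n Z with he
  have h0t : ∀ Z, 0 ∉ total a n Z := fun Z hZ => by
    have := total_subset a n Z hZ; simp at this
  have h0a : ∀ Z, 0 ∉ addend a n Z := fun Z hZ => by
    have := addend_subset a n Z hZ; simp at this
  have hIco : Ico 1 n ⊆ range n := fun i hi => by simp at hi ⊢; omega
  have heinj : Set.InjOn e (S : Set (Finset ℕ)) := by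
    intro Z hZ Z' hZ' hee
    have key : ∀ Z, (e Z).erase 0 = total a n Z := by
      intro Z
      simp only [he]
      split_ifs
      · exact erase_insert (h0t Z)
      · exact erase_eq_of_notMem (h0t Z)
    apply injOn_total a n (mem_coe.2 (mem_filter.1 hZ).1) (mem_coe.2 (mem_filter.1 hZ').1)
    rw [← key, ← key, hee]
  refine ⟨S.image e, ?_, ?_⟩
  · rw [card_image_of_injOn heinj]
    exact h a n J (D + 1) hn hJ hJc (by positivity) hD
  · intro u hu
    obtain ⟨Z, hZ, rfl⟩ := mem_image.1 hu
    have hw := (mem_filter.1 hZ).2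
    have hadd := sum_addend_add a hn Z
    rw [hsumα] at hadd
    obtain ⟨Q, hQ⟩ : ∃ Q, 2 ^ n = Q + 1 := ⟨2 ^ n - 1, by have := Nat.one_le_two_pow (n := n); omega⟩
    have hecard : #(total a n Z) ≤ #(e Z) := by
      simp only [he]; split_ifs
      · exact card_le_card (subset_insert _ _)
      · exact le_rfl
    have hesum : ∑ i ∈ e Z, 2 ^ i = ∑ i ∈ total a n Z, 2 ^ i + (carry a Z n).toNat := by
      simp only [he]; split_ifs with hcn
      · rw [sum_insert (h0t Z), hcn]; simp [add_comm]
      · simp [hcn]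
    refine ⟨?_, if a 0 then insert 0 (addend a n Z) else addend a n Z, ?_, ?_,
      (carry a Z n).toNat, ?_⟩
    · simp only [he]; split_ifs
      · exact insert_subset (by simp; omega) ((total_subset a n Z).trans hIco)
      · exact (total_subset a n Z).trans hIco
    · split_ifs
      · exact insert_subset (by simp; omega) ((addend_subset a n Z).trans hIco)
      · exact (addend_subset a n Z).trans hIco
    · have hy : #(if a 0 then insert 0 (addend a n Z) else addend a n Z) ≤ #(addend a n Z) + 1 := by
        split_ifs
        · exact card_insert_le _ _
        · exact Nat.le_succ _
      have : #(addend a n Z) + (D + 1) < #(total a n Z) := by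
        unfold weightDiff at hw
        have : (#(addend a n Z) : ℝ) + (D + 1) < #(total a n Z) := by linarith
        exact_mod_cast this
      omega
    · rw [hesum, hQ, Nat.add_sub_cancel]
      rw [hQ] at hadd
      have : ∑ i ∈ (if a 0 then insert 0 (addend a n Z) else addend a n Z), 2 ^ i
          = ∑ i ∈ addend a n Z, 2 ^ i + (a 0).toNat := by
        split_ifs with h
        · rw [sum_insert (h0a Z), h]; simp [add_comm]
        · simp [h]
      rw [this]
      linarith

/-! ### Runs of the binary representation and their boundaries -/

/-- The number of pairs of consecutive distinct entries. -/
def numChanges : List Bool → ℕ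
  | [] => 0
  | [_] => 0
  | x :: y :: l => (if x ≠ y then 1 else 0) + numChanges (y :: l)

theorem numChanges_replicate_append (L : ℕ) {x y : Bool} (h : x ≠ y) (l : List Bool) :
    numChanges (List.replicate (L + 1) x ++ y :: l) = 1 + numChanges (y :: l) := by
  induction L with
  | zero => simp [numChanges, h]
  | succ L ih =>
    rw [List.replicate_succ, List.replicate_succ] at *
    simpa [numChanges] using ih

theorem IsBlockForm.length_le {σ : List Bool} {B : List (ℕ × Bool)} (h : IsBlockForm σ B) :
    B.length ≤ numChanges σ + 1 := by
  obtain ⟨rfl, hpos, hchain⟩ := h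
  induction B with
  | nil => simp
  | cons p B ih =>
    cases B with
    | nil => simp
    | cons q B =>
      have hq := hpos q (by simp)
      have hp := hpos p (by simp)
      have := ih (fun r hr => hpos r (List.mem_cons_of_mem _ hr)) hchain.tail
      have hne : p.2 ≠ q.2 := hchain.rel
      obtain ⟨L, hL⟩ := Nat.exists_eq_add_of_lt hp
      obtain ⟨L', hL'⟩ := Nat.exists_eq_add_of_lt hq
      rw [zero_add] at hL hL'
      simp only [List.map_cons, List.flatten_cons, hL, hL', List.length_cons] at this ⊢
      rw [List.replicate_succ (n := L'), List.cons_append] at this ⊢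
      rw [numChanges_replicate_append L hne]
      omega

theorem binaryString_succ (n a : ℕ) :
    binaryString (n + 1) a = a.testBit n :: binaryString n a := by
  simp [binaryString, List.ofFn_succ, Fin.val_rev]

theorem numChanges_binaryString (n a : ℕ) :
    numChanges (binaryString (n + 1) a) = #{j ∈ range n | a.testBit j ≠ a.testBit (j + 1)} := by
  induction n with
  | zero => simp [binaryString, numChanges]
  | succ n ih =>
    rw [binaryString_succ, binaryString_succ n, numChanges, ← binaryString_succ, ih,
      range_add_one, filter_insert]
    by_cases h : a.testBit n = a.testBit (n + 1)
    · simp [h]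
    · rw [if_pos h, card_insert_of_notMem (by simp), if_pos (Ne.symm h)]
      ring

/-- The boundaries between consecutive runs, apart from those next to the ends of the string. -/
theorem IsBlockForm.length_le_card_boundaries {n a : ℕ} {B : List (ℕ × Bool)}
    (h : IsBlockForm (binaryString n a) B) :
    B.length ≤ #{j ∈ range n | 1 ≤ j ∧ j + 2 < n ∧ a.testBit j ≠ a.testBit (j + 1)} + 3 := by
  have hle := h.length_le
  cases n with
  | zero => simp [binaryString, numChanges] at hle; omega
  | succ n =>
    rw [numChanges_binaryString] at hle
    have hsub : {j ∈ range n | a.testBit j ≠ a.testBit (j + 1)} ⊆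
        {j ∈ range (n + 1) | 1 ≤ j ∧ j + 2 < n + 1 ∧ a.testBit j ≠ a.testBit (j + 1)}
          ∪ {0, n - 1} := by
      intro j
      simp only [mem_filter, mem_union, mem_insert, mem_singleton, mem_range]
      intro hj
      by_cases h0 : j = 0 ∨ j = n - 1
      · exact Or.inr h0
      · exact Or.inl ⟨by omega, by omega, by omega, hj.2⟩
    have h1 := (card_le_card hsub).trans (card_union_le _ _)
    have h2 : #({0, n - 1} : Finset ℕ) ≤ 2 := card_le_two
    omega

/-! ### Approximation of circuits by polynomials of low degree -/

/-- More than half of all linear combinations do not vanish at a given point where one of the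
functions is nonzero; so some linear combination vanishes on at most half of a set. -/
theorem exists_sum_mul_eq_zero_le {X ι : Type*} [Fintype ι] [DecidableEq ι] (B : Finset X)
    (g : ι → X → ZMod 2) (hg : ∀ x ∈ B, ∃ i, g i x ≠ 0) :
    ∃ w : ι → ZMod 2, 2 * #{x ∈ B | ∑ i, w i * g i x = 0} ≤ #B := by
  have hx : ∀ x ∈ B, 2 * #{w : ι → ZMod 2 | ∑ i, w i * g i x = 0} ≤ Fintype.card (ι → ZMod 2) := by
    intro x hxB
    obtain ⟨i, hi⟩ := hg x hxB
    -- Adding `1` to the weight of a function that is nonzero at `x` changes the value of the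
    -- combination, so zeros inject into nonzeros.
    have hinj : #{w : ι → ZMod 2 | ∑ i, w i * g i x = 0}
        ≤ #{w : ι → ZMod 2 | ¬ ∑ i, w i * g i x = 0} := by
      refine card_le_card_of_injOn (fun w => w + Pi.single i 1) ?_
        fun w _ w' _ h => add_right_cancel h
      intro w hw
      simp only [coe_filter, mem_univ, true_and, Set.mem_ofPred_eq] at hw ⊢
      simp only [Pi.add_apply, add_mul, sum_add_distrib, hw, zero_add, Pi.single_apply, ite_mul,
        one_mul, zero_mul, sum_ite_eq', mem_univ, if_true]
      simpa using hi
    have := card_filter_add_card_filter_not (s := (univ : Finset (ι → ZMod 2)))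
      (fun w => ∑ i, w i * g i x = 0)
    rw [card_univ] at this
    omega
  by_contra! hcon
  have h1 : ∑ w : ι → ZMod 2, #B < ∑ w : ι → ZMod 2, 2 * #{x ∈ B | ∑ i, w i * g i x = 0} :=
    sum_lt_sum_of_nonempty univ_nonempty fun w _ => hcon w
  have h2 : ∑ w : ι → ZMod 2, 2 * #{x ∈ B | ∑ i, w i * g i x = 0}
      = ∑ x ∈ B, 2 * #{w : ι → ZMod 2 | ∑ i, w i * g i x = 0} := by
    simp only [card_filter, mul_sum]
    exact sum_comm
  have h3 := sum_le_sum hx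
  rw [h2] at h1
  simp only [sum_const, smul_eq_mul, card_univ] at h1 h3
  rw [mul_comm] at h1
  omega

section LowDegree

variable (n : ℕ) (K : Type*) [Field K] [Algebra (ZMod 2) K]

/-- The `K`-valued functions on `𝔽₂ⁿ` that are polynomials of degree at most one. Its `r`-th power
consists of the polynomials of degree at most `r`. -/
def affineFunctions : Submodule K ((Fin n → ZMod 2) → K) :=
  Submodule.span K (insert 1 (Set.range fun i x => algebraMap (ZMod 2) K (x i)))

/-- The `K`-valued function given by an `𝔽₂`-valued function. -/
abbrev extendValues : ((Fin n → ZMod 2) → ZMod 2) →+* ((Fin n → ZMod 2) → K) :=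
  (algebraMap (ZMod 2) K).compLeft _

variable {n K}

theorem one_le_affineFunctions : 1 ≤ affineFunctions n K :=
  Submodule.one_le.2 (Submodule.subset_span (Set.mem_insert _ _))

theorem affineFunctions_pow_mono {r s : ℕ} (h : r ≤ s) :
    affineFunctions n K ^ r ≤ affineFunctions n K ^ s :=
  pow_le_pow_right' one_le_affineFunctions h

theorem one_mem_affineFunctions_pow (r : ℕ) : 1 ∈ affineFunctions n K ^ r :=
  affineFunctions_pow_mono (Nat.zero_le r) (by rw [pow_zero]; exact Submodule.one_le.1 le_rfl)

theorem extendValues_smul (a : ZMod 2) (f : (Fin n → ZMod 2) → ZMod 2) :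
    extendValues n K (fun x => a * f x) = algebraMap (ZMod 2) K a • extendValues n K f := by
  ext x; simp

/-- The approximation of a product of arbitrarily many functions by a product of `l` affine
combinations. -/
theorem exists_approx_prod {ι : Type*} [Fintype ι] [DecidableEq ι]
    (f : ι → (Fin n → ZMod 2) → ZMod 2) {r : ℕ}
    (hf : ∀ i, extendValues n K (f i) ∈ affineFunctions n K ^ r) (l : ℕ) :
    ∃ q : (Fin n → ZMod 2) → ZMod 2, extendValues n K q ∈ affineFunctions n K ^ (l * r) ∧
      (∀ x, (∀ i, f i x = 1) → q x = 1) ∧ #{x | q x ≠ ∏ i, f i x} * 2 ^ l ≤ 2 ^ n := by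
  have hZ : ∀ a : ZMod 2, a ≠ 1 → a = 0 := by decide
  have hZ' : ∀ a : ZMod 2, a ≠ 0 → 1 + a = 0 := by decide
  have hZ'' : ∀ a : ZMod 2, a ≠ 1 → 1 + a ≠ 0 := by decide
  induction l with
  | zero =>
    refine ⟨1, by simp [Submodule.one_le.1 le_rfl], fun _ _ => rfl, ?_⟩
    simpa using card_filter_le (univ : Finset (Fin n → ZMod 2)) fun x => 1 ≠ ∏ i, f i x
  | succ l ih =>
    obtain ⟨q, hq, hq1, hqc⟩ := ih
    have hB : ∀ x ∈ ({x | q x ≠ ∏ i, f i x} : Finset (Fin n → ZMod 2)), ∃ i, 1 + f i x ≠ 0 := by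
      intro x hx
      simp only [mem_filter, mem_univ, true_and] at hx
      by_contra! h
      have h1 : ∀ i, f i x = 1 := fun i => by
        by_contra hne; exact hZ'' _ hne (h i)
      exact hx (by rw [hq1 x h1, prod_eq_one fun i _ => h1 i])
    obtain ⟨w, hw⟩ := exists_sum_mul_eq_zero_le _ (fun i x => 1 + f i x) hB
    -- The new factor is `1` wherever all `f i` are `1`, so `q` can err only where the product is
    -- `0`. There the error survives only if the combination vanishes, and `w` was chosen to make
    -- that happen on at most half of the error set.
    refine ⟨q * (1 + ∑ i, fun x => w i * (1 + f i) x), ?_, ?_, ?_⟩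
    · rw [map_mul, Nat.succ_mul, pow_add]
      refine Submodule.mul_mem_mul hq ?_
      rw [map_add, map_one, map_sum]
      refine add_mem (one_mem_affineFunctions_pow r) (sum_mem fun i _ => ?_)
      rw [extendValues_smul, map_add, map_one]
      exact Submodule.smul_mem _ _ (add_mem (one_mem_affineFunctions_pow r) (hf i))
    · intro x hx
      have : (1 : ZMod 2) + 1 = 0 := by decide
      simp [hq1 x hx, hx, this]
    · have hsub : ({x | (q * (1 + ∑ i, fun x => w i * (1 + f i) x)) x ≠ ∏ i, f i x} :
          Finset (Fin n → ZMod 2)) ⊆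
          {x ∈ ({x | q x ≠ ∏ i, f i x} : Finset (Fin n → ZMod 2)) |
            ∑ i, w i * (1 + f i x) = 0} := by
        intro x
        simp only [mem_filter, mem_univ, true_and, Pi.mul_apply, Pi.add_apply, Pi.one_apply,
          Finset.sum_apply]
        intro hx
        by_cases hall : ∀ i, f i x = 1
        · exfalso
          have : (1 : ZMod 2) + 1 = 0 := by decide
          apply hx
          simp [hq1 x hall, hall, this]
        · push Not at hall
          obtain ⟨i, hi⟩ := hall
          have h0 : ∏ i, f i x = 0 := prod_eq_zero (mem_univ i) (hZ _ hi)
          rw [h0] at hx ⊢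
          refine ⟨left_ne_zero_of_mul hx, ?_⟩
          by_contra hne
          exact right_ne_zero_of_mul hx (hZ' _ hne)
      have := card_le_card hsub
      calc _ ≤ #{x ∈ ({x | q x ≠ ∏ i, f i x} : Finset (Fin n → ZMod 2)) |
            ∑ i, w i * (1 + f i x) = 0} * 2 ^ (l + 1) := by gcongr
        _ = 2 * #{x ∈ ({x | q x ≠ ∏ i, f i x} : Finset (Fin n → ZMod 2)) |
            ∑ i, w i * (1 + f i x) = 0} * 2 ^ l := by ring
        _ ≤ #{x | q x ≠ ∏ i, f i x} * 2 ^ l := by gcongr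
        _ ≤ 2 ^ n := hqc

namespace ArithCircuit

theorem Wire.extendValues_mem {k l : ℕ} {p : Fin k → (Fin n → ZMod 2) → ZMod 2}
    {δ : Fin k → ℕ} (hp : ∀ j, extendValues n K (p j) ∈ affineFunctions n K ^ l ^ δ j)
    (w : Wire n k) : extendValues n K (fun x => w.eval x fun j => p j x)
      ∈ affineFunctions n K ^ l ^ w.depth δ := by
  cases w with
  | var i =>
    simp only [Wire.depth, pow_zero, pow_one]
    exact Submodule.subset_span (Set.mem_insert_of_mem _ ⟨i, rfl⟩)
  | const a =>
    have : extendValues n K (fun _ => a) = algebraMap (ZMod 2) K a • 1 := by ext; simp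
    simp only [Wire.eval, this]
    exact Submodule.smul_mem _ _ (one_mem_affineFunctions_pow _)
  | gate j => exact hp j

theorem le_foldr_max {l : List ℕ} {a : ℕ} (h : a ∈ l) : a ≤ l.foldr max 0 := by
  induction l with
  | nil => simp at h
  | cons b l ih =>
    rcases List.mem_cons.1 h with rfl | h
    · exact le_max_left _ _
    · exact (ih h).trans (le_max_right _ _)

theorem Gate.exists_approx {k l : ℕ} (hl : 1 ≤ l) {p : Fin k → (Fin n → ZMod 2) → ZMod 2}
    {δ : Fin k → ℕ} (hp : ∀ j, extendValues n K (p j) ∈ affineFunctions n K ^ l ^ δ j)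
    (g : Gate n k) : ∃ q : (Fin n → ZMod 2) → ZMod 2,
      extendValues n K q ∈ affineFunctions n K ^ l ^ g.depth δ ∧
      #{x | q x ≠ g.eval x fun j => p j x} * 2 ^ l ≤ 2 ^ n := by
  have hargs : ∀ (args : List (Wire n k)) (i : Fin args.length),
      extendValues n K (fun x => args[i].eval x fun j => p j x)
        ∈ affineFunctions n K ^ l ^ (args.map (Wire.depth δ)).foldr max 0 := by
    intro args i
    refine affineFunctions_pow_mono ?_ (args[i].extendValues_mem hp)
    exact Nat.pow_le_pow_right hl (le_foldr_max (List.mem_map_of_mem (List.getElem_mem _)))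
  cases g with
  | add args =>
    refine ⟨fun x => (args.map (Wire.eval x fun j => p j x)).sum, ?_, by simp [Gate.eval]⟩
    have : (fun x => (args.map (Wire.eval x fun j => p j x)).sum)
        = ∑ i : Fin args.length, fun x => args[i].eval x fun j => p j x := by
      ext x
      rw [Finset.sum_apply, ← Fin.sum_univ_fun_getElem]
      rfl
    rw [this, map_sum]
    refine affineFunctions_pow_mono ?_ (sum_mem fun i _ => hargs args i)
    exact Nat.pow_le_pow_right hl (Nat.le_succ _)
  | mul args =>
    obtain ⟨q, hq, -, hqc⟩ := exists_approx_prod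
      (fun (i : Fin args.length) x => args[i].eval x fun j => p j x) (hargs args) l
    refine ⟨q, ?_, ?_⟩
    · rwa [Gate.depth, pow_succ']
    · convert hqc using 6 with x
      rw [Gate.eval, ← Fin.prod_univ_fun_getElem]
      rfl

/-- All gates of a circuit are approximated simultaneously by functions of low degree. -/
theorem Gates.exists_approx {l : ℕ} (hl : 1 ≤ l) {k : ℕ} (gs : Gates n k) :
    ∃ p : Fin k → (Fin n → ZMod 2) → ZMod 2,
      (∀ j, extendValues n K (p j) ∈ affineFunctions n K ^ l ^ gs.depth j) ∧
      #{x | ∃ j, p j x ≠ gs.eval x j} * 2 ^ l ≤ k * 2 ^ n := by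
  induction gs with
  | nil => exact ⟨fun j => j.elim0, fun j => j.elim0, by simp⟩
  | @snoc k gs g ih =>
    obtain ⟨p, hp, hpc⟩ := ih
    obtain ⟨q, hq, hqc⟩ := g.exists_approx hl hp
    refine ⟨Fin.snoc (α := fun _ => (Fin n → ZMod 2) → ZMod 2) p q, ?_, ?_⟩
    · intro j
      refine Fin.lastCases ?_ (fun j => ?_) j
      · simpa [Gates.depth] using hq
      · simpa [Gates.depth] using hp j
    · have hsub : ({x | ∃ j, Fin.snoc (α := fun _ => (Fin n → ZMod 2) → ZMod 2) p q j x
            ≠ (gs.snoc g).eval x j} : Finset (Fin n → ZMod 2)) ⊆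
          ({x | ∃ j, p j x ≠ gs.eval x j} : Finset (Fin n → ZMod 2))
            ∪ ({x | q x ≠ g.eval x fun j => p j x} : Finset (Fin n → ZMod 2)) := by
        intro x
        simp only [mem_filter, mem_univ, true_and, mem_union]
        rintro ⟨j, hj⟩
        by_contra! hcon
        have hv : (fun j => p j x) = gs.eval x := funext hcon.1
        revert hj
        refine Fin.lastCases ?_ (fun j => ?_) j
        · simp [Gates.eval, hcon.2, hv]
        · simp [Gates.eval, hcon.1]
      have := (card_le_card hsub).trans (card_union_le _ _)
      calc _ ≤ (#{x | ∃ j, p j x ≠ gs.eval x j} + #{x | q x ≠ g.eval x fun j => p j x}) * 2 ^ l := by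
            gcongr
        _ ≤ (k + 1) * 2 ^ n := by rw [add_mul, add_mul, one_mul]; gcongr

/-- All outputs of a circuit are approximated simultaneously by functions of low degree. -/
theorem exists_approx {m l d : ℕ} (hl : 1 ≤ l) (C : ArithCircuit n m) (hd : C.depth ≤ d) :
    ∃ p : Fin m → (Fin n → ZMod 2) → ZMod 2,
      (∀ i, extendValues n K (p i) ∈ affineFunctions n K ^ l ^ d) ∧
      #{x | (fun i => p i x) ≠ C.eval x} * 2 ^ l ≤ C.size * 2 ^ n := by
  obtain ⟨p, hp, hpc⟩ := C.gates.exists_approx (K := K) hl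
  refine ⟨fun i x => (C.output i).eval x fun j => p j x, fun i => ?_, le_trans ?_ hpc⟩
  · refine affineFunctions_pow_mono (Nat.pow_le_pow_right hl (le_trans ?_ hd))
      ((C.output i).extendValues_mem hp)
    exact le_sup (f := fun i => (C.output i).depth C.gates.depth) (mem_univ i)
  · gcongr with x
    intro hne
    by_contra! hcon
    exact hne (funext fun i => congrArg (fun v => (C.output i).eval x v) (funext hcon))

end ArithCircuit

end LowDegree

/-! ### Power functions and polynomials of low degree -/

section

variable {n : ℕ} {K : Type*} [Field K] [Algebra (ZMod 2) K]

/-- Since `a * a = a` in `𝔽₂`, multilinear monomials suffice. -/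
theorem affineFunctions_pow_le (r : ℕ) : affineFunctions n K ^ r ≤ Submodule.span K (Set.range
    fun (u : {u : Finset (Fin n) // #u ≤ r}) x => ∏ i ∈ u.1, algebraMap (ZMod 2) K (x i)) := by
  induction r with
  | zero =>
    rw [pow_zero, Submodule.one_le]
    exact Submodule.subset_span ⟨⟨∅, by simp⟩, by ext; simp⟩
  | succ r ih =>
    rw [pow_succ]
    refine (mul_le_mul' ih le_rfl).trans ?_
    rw [affineFunctions, Submodule.span_mul_span]
    refine Submodule.span_mono ?_
    rintro _ ⟨_, ⟨⟨u, hu⟩, rfl⟩, _, rfl | ⟨i, rfl⟩, rfl⟩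
    · exact ⟨⟨u, hu.trans (Nat.le_succ r)⟩, by ext; simp⟩
    · refine ⟨⟨insert i u, (card_insert_le _ _).trans (by omega)⟩, ?_⟩
      ext x
      simp only [Pi.mul_apply]
      by_cases hi : i ∈ u
      · have hsq : ∀ a : ZMod 2, a * a = a := by decide
        rw [insert_eq_of_mem hi, ← prod_erase_mul u _ hi, mul_assoc, ← map_mul, hsq]
      · rw [prod_insert hi, mul_comm]

theorem finrank_affineFunctions_pow_le (r : ℕ) :
    Module.finrank K ↥(affineFunctions n K ^ r) ≤ #{u ∈ (range n).powerset | #u ≤ r} := by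
  refine (Submodule.finrank_mono (affineFunctions_pow_le r)).trans
    ((finrank_range_le_card _).trans ?_)
  rw [Fintype.card_subtype]
  refine card_le_card_of_injOn (fun u => u.map Fin.valEmbedding) ?_
    fun u _ v _ h => map_injective _ h
  intro u hu
  simp only [coe_filter, mem_univ, true_and, Set.mem_ofPred_eq, mem_powerset, card_map] at hu ⊢
  refine ⟨fun i hi => ?_, hu⟩
  obtain ⟨j, -, rfl⟩ := mem_map.1 hi
  simp

variable (b : Module.Basis (Fin n) (ZMod 2) K)

/-- The power function with exponent `∑ i ∈ u, 2 ^ i`, in coordinates with respect to `b`. -/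
noncomputable def powerFunction (u : Finset ℕ) (x : Fin n → ZMod 2) : K :=
  b.equivFun.symm x ^ ∑ i ∈ u, 2 ^ i

/-- Iterated Frobenius is `𝔽₂`-linear, hence a linear form in the coordinates with coefficients in
`K`. -/
theorem pow_two_pow_mem_affineFunctions (i : ℕ) :
    (fun x => b.equivFun.symm x ^ 2 ^ i) ∈ affineFunctions n K := by
  have : CharP K 2 := charP_of_injective_algebraMap (algebraMap (ZMod 2) K).injective 2
  have h2 : ∀ a : ZMod 2, a ^ 2 ^ i = a := fun a => by
    simp
  have : (fun x => b.equivFun.symm x ^ 2 ^ i)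
      = ∑ j, (b j ^ 2 ^ i) • fun x : Fin n → ZMod 2 => algebraMap (ZMod 2) K (x j) := by
    ext x
    rw [b.equivFun_symm_apply, sum_pow_char_pow, Finset.sum_apply]
    refine sum_congr rfl fun j _ => ?_
    rw [Algebra.smul_def, mul_pow, ← map_pow, h2, mul_comm]
    rfl
  rw [this]
  exact sum_mem fun j _ => Submodule.smul_mem _ _
    (Submodule.subset_span (Set.mem_insert_of_mem _ ⟨j, rfl⟩))

theorem powerFunction_mem (u : Finset ℕ) : powerFunction b u ∈ affineFunctions n K ^ #u := by
  have : powerFunction b u = ∏ i ∈ u, fun x => b.equivFun.symm x ^ 2 ^ i := by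
    ext x
    rw [powerFunction, Finset.prod_apply, prod_pow_eq_pow_sum]
  rw [this]
  clear this
  induction u using Finset.induction_on with
  | empty => simp [Submodule.one_le.1 le_rfl]
  | insert i u hi ih =>
    rw [prod_insert hi, card_insert_of_notMem hi, pow_succ']
    exact Submodule.mul_mem_mul (pow_two_pow_mem_affineFunctions b i) ih

theorem linearIndependent_pow_functions {F : Type*} [Field F] [Fintype F] :
    LinearIndependent F fun (k : Fin (Fintype.card F)) (y : F) => y ^ (k : ℕ) := by
  classical
  rw [Fintype.linearIndependent_iff]
  intro g hg k
  set p : Polynomial F := ∑ k : Fin (Fintype.card F), Polynomial.C (g k) * Polynomial.X ^ (k : ℕ)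
    with hp
  have hcoeff : p.coeff k = g k := by
    simp [hp, Polynomial.coeff_X_pow, Fin.val_inj]
  have hdeg : p.degree < Fintype.card F := by
    refine (Polynomial.degree_sum_le _ _).trans_lt ?_
    rw [Finset.sup_lt_iff (by exact WithBot.bot_lt_coe _)]
    intro k _
    exact (Polynomial.degree_C_mul_X_pow_le _ _).trans_lt (by exact_mod_cast k.2)
  have hzero : p = 0 := by
    refine Polynomial.eq_zero_of_degree_lt_of_eval_finset_eq_zero (univ : Finset F)
      (by simpa using hdeg) fun y _ => ?_
    have := congrFun hg y
    simpa [hp, Polynomial.eval_finsetSum] using this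
  rw [← hcoeff, hzero, Polynomial.coeff_zero]

theorem sum_two_pow_lt {u : Finset ℕ} (hu : u ⊆ range n) : ∑ i ∈ u, 2 ^ i < 2 ^ n :=
  Nat.geomSum_lt le_rfl fun _ hi => mem_range.1 (hu hi)

/-- Distinct sets of digits give distinct exponents below `2 ^ n = |K|`, and a nonzero polynomial of
degree below `|K|` cannot vanish on all of `K`. -/
theorem linearIndependent_pow_functionserFunction (hK : Nat.card K = 2 ^ n) :
    LinearIndependent K fun u : {u // u ∈ (range n).powerset} => powerFunction b u.1 := by
  have : Finite K := Nat.finite_of_card_ne_zero (by rw [hK]; positivity)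
  have := Fintype.ofFinite K
  rw [Nat.card_eq_fintype_card] at hK
  have h1 := (linearIndependent_pow_functions (F := K)).comp
    (fun u : {u // u ∈ (range n).powerset} => (⟨∑ i ∈ u.1, 2 ^ i, by
      rw [hK]; exact sum_two_pow_lt (mem_powerset.1 u.2)⟩ : Fin (Fintype.card K))) fun u v huv => by
        apply Subtype.ext
        exact geomSum_injective le_rfl (Fin.mk.inj huv)
  exact h1.map' (LinearMap.funLeft K K b.equivFun.symm)
    (LinearMap.ker_eq_bot.2 (LinearMap.funLeft_injective_of_surjective K K _
      b.equivFun.symm.surjective))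

/-- A dimension count: the independent powers of weight at most `r` are as many as the multilinear
monomials of degree at most `r`, which span a space containing `affineFunctions n K ^ r`. -/
theorem span_powerFunction (hK : Nat.card K = 2 ^ n) (r : ℕ) :
    Submodule.span K (Set.range fun u : {u // u ∈ (range n).powerset ∧ #u ≤ r} =>
      powerFunction b u.1) = affineFunctions n K ^ r := by
  have hle : Submodule.span K (Set.range fun u : {u // u ∈ (range n).powerset ∧ #u ≤ r} =>
      powerFunction b u.1) ≤ affineFunctions n K ^ r := by
    rw [Submodule.span_le]
    rintro _ ⟨u, rfl⟩
    exact affineFunctions_pow_mono u.2.2 (powerFunction_mem b u.1)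
  have : Fintype {u // u ∈ (range n).powerset ∧ #u ≤ r} :=
    Fintype.subtype {u ∈ (range n).powerset | #u ≤ r} (by simp)
  have hli := (linearIndependent_pow_functionserFunction b hK).comp
    (fun u : {u // u ∈ (range n).powerset ∧ #u ≤ r} => ⟨u.1, u.2.1⟩)
    fun u v h => Subtype.ext (congrArg (fun w : {u // u ∈ (range n).powerset} => w.1) h)
  refine Submodule.eq_of_le_of_finrank_le hle ?_
  refine (finrank_affineFunctions_pow_le r).trans (le_of_eq ?_)
  rw [finrank_span_eq_card (R := K) (b := fun u : {u // u ∈ (range n).powerset ∧ #u ≤ r} =>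
    powerFunction b u.1) hli]
  exact (Fintype.card_of_subtype _ (by simp)).symm

/-- If on `S` each power function from a family `E` is a function of degree smaller than its own,
then the other power functions span the functions on `S`. -/
theorem card_add_card_le (hK : Nat.card K = 2 ^ n) (S : Finset (Fin n → ZMod 2))
    (E : Finset (Finset ℕ)) (hE : ∀ e ∈ E, e ⊆ range n ∧ ∃ r < #e, ∃ g ∈ affineFunctions n K ^ r,
      ∀ x ∈ S, powerFunction b e x = g x) : #S + #E ≤ 2 ^ n := by
  set M := Submodule.span K (Set.range fun u : {u // u ∈ (range n).powerset \ E} =>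
    powerFunction b u.1) with hM
  -- Strong induction on the degree: a power from `E` is replaced on `S` by a function of smaller
  -- degree, so the rewriting terminates.
  have hred : ∀ r, ∀ f ∈ affineFunctions n K ^ r, ∃ g ∈ M, ∀ x ∈ S, f x = g x := by
    intro r
    induction r using Nat.strong_induction_on with
    | _ r ih =>
      intro f hf
      rw [← span_powerFunction b hK] at hf
      induction hf using Submodule.span_induction with
      | mem f hf =>
        obtain ⟨⟨u, hu, hur⟩, rfl⟩ := hf
        by_cases huE : u ∈ E
        · obtain ⟨-, r', hr', g, hg, hgS⟩ := hE u huE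
          obtain ⟨g', hg', hgS'⟩ := ih r' (hr'.trans_le hur) g hg
          exact ⟨g', hg', fun x hx => (hgS x hx).trans (hgS' x hx)⟩
        · exact ⟨_, Submodule.subset_span ⟨⟨u, mem_sdiff.2 ⟨hu, huE⟩⟩, rfl⟩, fun _ _ => rfl⟩
      | zero => exact ⟨0, zero_mem _, fun _ _ => rfl⟩
      | add f f' _ _ hf hf' =>
        obtain ⟨g, hg, hgS⟩ := hf
        obtain ⟨g', hg', hgS'⟩ := hf'
        exact ⟨g + g', add_mem hg hg', fun x hx => by simp [hgS x hx, hgS' x hx]⟩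
      | smul a f _ hf =>
        obtain ⟨g, hg, hgS⟩ := hf
        exact ⟨a • g, Submodule.smul_mem _ _ hg, fun x hx => by simp [hgS x hx]⟩
  have htop : affineFunctions n K ^ n = ⊤ := by
    refine Submodule.eq_top_of_finrank_eq (le_antisymm (Submodule.finrank_le _) ?_)
    rw [← span_powerFunction b hK]
    have hli := linearIndependent_pow_functionserFunction b hK
    have h1 := finrank_span_eq_card (R := K) hli
    have h2 : (Set.range fun u : {u // u ∈ (range n).powerset} => powerFunction b u.1) ⊆
        Set.range fun u : {u // u ∈ (range n).powerset ∧ #u ≤ n} => powerFunction b u.1 := by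
      rintro _ ⟨⟨u, hu⟩, rfl⟩
      exact ⟨⟨u, hu, by simpa using card_le_card (mem_powerset.1 hu)⟩, rfl⟩
    refine le_trans ?_ (Submodule.finrank_mono (Submodule.span_mono h2))
    rw [h1, Module.finrank_fintype_fun_eq_card]
    simp
  set R : ((Fin n → ZMod 2) → K) →ₗ[K] (S → K) := LinearMap.funLeft K K Subtype.val with hR
  have hsurj : Submodule.map R M = ⊤ := by
    rw [eq_top_iff]
    rintro f -
    obtain ⟨f', rfl⟩ := LinearMap.funLeft_surjective_of_injective K K (Subtype.val : S → _)
      Subtype.val_injective f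
    obtain ⟨g, hg, hgS⟩ := hred n f' (by rw [htop]; trivial)
    refine ⟨g, hg, ?_⟩
    ext x
    exact (hgS x x.2).symm
  have h1 : #S ≤ Module.finrank K M := by
    have := Submodule.finrank_map_le R M
    rw [hsurj, finrank_top, Module.finrank_fintype_fun_eq_card, Fintype.card_coe] at this
    exact this
  have h2 : Module.finrank K M ≤ #((range n).powerset \ E) := by
    refine (finrank_range_le_card _).trans (le_of_eq ?_)
    rw [Fintype.card_coe]
  have hsub : E ⊆ (range n).powerset := fun e he => mem_powerset.2 (hE e he).1
  have h3 := card_sdiff_add_card_eq_card hsub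
  rw [card_powerset, card_range] at h3
  omega

end

section

variable {n : ℕ} {K : Type*} [Field K] [Algebra (ZMod 2) K]

theorem combination_mem_affineFunctions_pow (b : Module.Basis (Fin n) (ZMod 2) K) {r : ℕ}
    {p : Fin n → (Fin n → ZMod 2) → ZMod 2}
    (hp : ∀ i, extendValues n K (p i) ∈ affineFunctions n K ^ r) :
    (fun x => b.equivFun.symm fun i => p i x) ∈ affineFunctions n K ^ r := by
  have : (fun x => b.equivFun.symm fun i => p i x) = ∑ i, b i • extendValues n K (p i) := by
    ext x
    rw [b.equivFun_symm_apply, Finset.sum_apply]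
    refine sum_congr rfl fun i _ => ?_
    rw [Algebra.smul_def, mul_comm]
    rfl
  rw [this]
  exact sum_mem fun i _ => Submodule.smul_mem _ _ (hp i)

/-- A function of degree at most `D` agrees with the `α`-th power function on at most `2 ^ n - #E`
points, if cyclic addition of `α` raises the weight by more than `D` on a set with `#E` distinct
sums. -/
theorem card_agree_add_card_le (b : Module.Basis (Fin n) (ZMod 2) K) (hK : Nat.card K = 2 ^ n)
    {D α : ℕ} {P : (Fin n → ZMod 2) → K} (hP : P ∈ affineFunctions n K ^ D)
    (S : Finset (Fin n → ZMod 2)) (hS : ∀ x ∈ S, P x = b.equivFun.symm x ^ α)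
    (E : Finset (Finset ℕ)) (hE : ∀ e ∈ E, e ⊆ range n ∧ ∃ y ⊆ range n, #y + D < #e ∧ ∃ q : ℕ,
      ∑ i ∈ y, 2 ^ i + α = ∑ i ∈ e, 2 ^ i + (2 ^ n - 1) * q) : #S + #E ≤ 2 ^ n := by
  refine card_add_card_le b hK S E fun e he => ?_
  obtain ⟨hen, y, hyn, hlt, q, hq⟩ := hE e he
  refine ⟨hen, #y + D, hlt, powerFunction b y * P, ?_, fun x hx => ?_⟩
  · rw [pow_add]
    exact Submodule.mul_mem_mul (powerFunction_mem b y) hP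
  · rw [Pi.mul_apply, hS x hx, powerFunction, powerFunction, ← pow_add, hq]
    have : Finite K := Nat.finite_of_card_ne_zero (by rw [hK]; positivity)
    have := Fintype.ofFinite K
    rcases eq_or_ne (b.equivFun.symm x) 0 with h0 | h0
    -- At `0` reducing exponents modulo `2 ^ n - 1` is safe only between positive exponents; `#y + D
    -- < #e` makes `e` nonempty.
    · have hpos : 0 < ∑ i ∈ e, 2 ^ i :=
        sum_pos (fun i _ => by positivity) (card_pos.1 (by omega))
      rw [h0, zero_pow hpos.ne', zero_pow (by omega)]
    · have h1 := FiniteField.pow_card_sub_one_eq_one _ h0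
      rw [← Nat.card_eq_fintype_card, hK] at h1
      rw [pow_add, pow_mul, h1, one_pow, mul_one]

end

/-! ### Combining the bounds and choosing the parameters -/

theorem ArithCircuit.ncard_evalField_eq_pow_le {n d l t D α : ℕ} (hn : n ≠ 0)
    (hl : 1 ≤ l) (hD : l ^ d = D) (b : Module.Basis (Fin n) (ZMod 2) (GaloisField 2 n))
    (C : ArithCircuit n n) (hC : C.depth ≤ d) (hs : C.size * 2 ^ t ≤ 2 ^ l)
    (E : Finset (Finset ℕ)) (hE : ∀ e ∈ E, e ⊆ range n ∧ ∃ y ⊆ range n, #y + D < #e ∧ ∃ q : ℕ,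
      ∑ i ∈ y, 2 ^ i + α = ∑ i ∈ e, 2 ^ i + (2 ^ n - 1) * q) :
    ∃ β : ℕ, β * 2 ^ t ≤ 2 ^ n ∧
      Set.ncard {x : GaloisField 2 n | C.evalField b x = x ^ α} + #E ≤ 2 ^ n + β := by
  classical
  obtain ⟨p, hp, hbad⟩ := C.exists_approx (K := GaloisField 2 n) hl hC
  rw [hD] at hp
  refine ⟨#{x | (fun i => p i x) ≠ C.eval x},
    le_of_mul_le_mul_right ?_ (show 0 < 2 ^ l by positivity), ?_⟩
  · calc _ = #{x | (fun i => p i x) ≠ C.eval x} * 2 ^ l * 2 ^ t := by ring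
      _ ≤ C.size * 2 ^ n * 2 ^ t := by gcongr
      _ = C.size * 2 ^ t * 2 ^ n := by ring
      _ ≤ 2 ^ l * 2 ^ n := by gcongr
      _ = _ := by ring
  set S : Finset (Fin n → ZMod 2) :=
    {x | (b.equivFun.symm fun i => p i x) = b.equivFun.symm x ^ α} with hS
  have hagree := card_agree_add_card_le b (GaloisField.card 2 n hn)
    (combination_mem_affineFunctions_pow b hp) S (fun x hx => (mem_filter.1 hx).2) E hE
  have hset : {x : GaloisField 2 n | C.evalField b x = x ^ α}
      ⊆ b.equivFun.symm '' (S ∪ ({x | (fun i => p i x) ≠ C.eval x} :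
        Finset (Fin n → ZMod 2)) : Finset (Fin n → ZMod 2)) := by
    intro x hx
    refine ⟨b.equivFun x, ?_, b.equivFun.symm_apply_apply x⟩
    simp only [coe_union, Set.mem_union, mem_coe, hS, mem_filter, mem_univ, true_and]
    by_cases h : (fun i => p i (b.equivFun x)) = C.eval (b.equivFun x)
    · left
      rw [h, b.equivFun.symm_apply_apply]
      exact hx
    · exact Or.inr h
  have hcard := (Set.ncard_le_ncard hset (Set.toFinite _)).trans
    (Set.ncard_image_le (Set.toFinite _))
  rw [Set.ncard_coe_finset] at hcard
  have := hcard.trans (card_union_le _ _)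
  omega

/-- The left side is of order `n ^ (1 / 5)`, which leaves a factor `n ^ (3 / 10)` to absorb the
constants. -/
theorem eventually_degree_le (K : ℝ) (hK : 0 < K) (t d : ℕ) (hd : 1 ≤ d) :
    ∃ N : ℕ, ∀ n : ℕ, N ≤ n →
      (((⌈(n : ℝ) ^ (1 / (5 * (d : ℝ)))⌉₊ + t) ^ d : ℕ) : ℝ) + 1 ≤ K * √n := by
  set A : ℝ := ((t : ℝ) + 2) ^ d + 1 with hA
  have htend := (tendsto_rpow_atTop (show (0 : ℝ) < 3 / 10 by norm_num)).comp
    tendsto_natCast_atTop_atTop (α := ℕ)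
  obtain ⟨N, hN⟩ := Filter.eventually_atTop.1 (htend.eventually_ge_atTop (A / K))
  refine ⟨max N 1, fun n hn => ?_⟩
  have hn1 : (1 : ℝ) ≤ n := by exact_mod_cast (le_max_right N 1).trans hn
  have hbig := hN n ((le_max_left N 1).trans hn)
  simp only [Function.comp_apply, div_le_iff₀ hK] at hbig
  set x := (n : ℝ) ^ (1 / (5 * (d : ℝ))) with hx
  have hd' : (0 : ℝ) < d := by exact_mod_cast hd
  have hx1 : 1 ≤ x := Real.one_le_rpow hn1 (by positivity)
  have hxd : x ^ d = (n : ℝ) ^ (1 / 5 : ℝ) := by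
    rw [hx, ← Real.rpow_natCast, ← Real.rpow_mul (by positivity)]
    congr 1
    field_simp
  have hy1 : (1 : ℝ) ≤ (n : ℝ) ^ (1 / 5 : ℝ) := Real.one_le_rpow hn1 (by norm_num)
  have hl : ((⌈x⌉₊ + t : ℕ) : ℝ) ≤ (t + 2) * x := by
    have := Nat.ceil_lt_add_one (zero_le_one.trans hx1)
    push_cast
    nlinarith [(Nat.cast_nonneg t : (0 : ℝ) ≤ t)]
  have hsqrt : √(n : ℝ) = (n : ℝ) ^ (1 / 5 : ℝ) * (n : ℝ) ^ (3 / 10 : ℝ) := by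
    rw [Real.sqrt_eq_rpow, ← Real.rpow_add (by linarith)]
    norm_num
  calc (((⌈x⌉₊ + t) ^ d : ℕ) : ℝ) + 1 ≤ ((t + 2) * x) ^ d + 1 := by
        rw [Nat.cast_pow]; gcongr
    _ = ((t : ℝ) + 2) ^ d * (n : ℝ) ^ (1 / 5 : ℝ) + 1 := by rw [mul_pow, hxd]
    _ ≤ A * (n : ℝ) ^ (1 / 5 : ℝ) := by rw [hA]; linarith
    _ ≤ (n : ℝ) ^ (3 / 10 : ℝ) * K * (n : ℝ) ^ (1 / 5 : ℝ) := by gcongr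
    _ = K * √n := by rw [hsqrt]; ring

end Powering

theorem theorem2 (c : ℝ) (hc : 0 < c) (d : ℕ) (hd : 1 ≤ d) :
    ∃ ε₀ : ℝ, 0 < ε₀ ∧ ∃ N : ℕ, ∀ n : ℕ, N ≤ n →
      ∀ (α : ZMod (2 ^ n - 1)) (B : List (ℕ × Bool)),
        IsBlockForm (binaryString n α.val) B → c * (n : ℝ) ≤ (B.length : ℝ) →
      ∀ (b : Module.Basis (Fin n) (ZMod 2) (GaloisField 2 n)) (C : ArithCircuit n n),
        C.depth ≤ d → (C.size : ℝ) ≤ (2 : ℝ) ^ ((n : ℝ) ^ (1 / (5 * (d : ℝ)))) →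
          (Set.ncard {x : GaloisField 2 n | C.evalField b x = x ^ α.val} : ℝ)
              / (Nat.card (GaloisField 2 n) : ℝ) ≤ 1 - ε₀ := by
  obtain ⟨K, hK, δ, hδ, hweight⟩ := exists_card_cyclic_add_ge (c / 2) (half_pos hc)
  -- The extra `t` in `l` brings the approximation error below `δ / 2`, half of the fraction of
  -- redundant powers.
  obtain ⟨t, ht⟩ := exists_pow_lt_of_lt_one (half_pos hδ) (show (1 / 2 : ℝ) < 1 by norm_num)
  obtain ⟨N, hN⟩ := eventually_degree_le K hK t d hd
  -- The bound `6 / c` gives `3 ≤ c * n / 2`, so the three runs not matched by an interior boundary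
  -- cost at most half of `c * n`.
  refine ⟨δ / 2, half_pos hδ, max (max N 1) ⌈6 / c⌉₊, fun n hn α B hB hBc b C hC hsize => ?_⟩
  simp only [max_le_iff] at hn
  obtain ⟨⟨hNn, hn1⟩, hnc⟩ := hn
  have hpow : 2 ≤ 2 ^ n := by
    calc 2 = 2 ^ 1 := rfl
      _ ≤ 2 ^ n := Nat.pow_le_pow_right (by norm_num) hn1
  have : NeZero (2 ^ n - 1) := ⟨by omega⟩
  have hα : α.val < 2 ^ n := α.val_lt.trans_le (Nat.sub_le _ _)
  have hrpos : (1 : ℝ) ≤ (n : ℝ) ^ (1 / (5 * (d : ℝ))) :=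
    Real.one_le_rpow (by exact_mod_cast hn1) (by positivity)
  set r := (n : ℝ) ^ (1 / (5 * (d : ℝ)))
  set l := ⌈r⌉₊ + t with hl
  have hl1 : 1 ≤ l := by
    have : 0 < ⌈r⌉₊ := Nat.ceil_pos.2 (by linarith)
    omega
  have hJ : c / 2 * n ≤ (Finset.card {j ∈ Finset.range n | 1 ≤ j ∧ j + 2 < n ∧
      α.val.testBit j ≠ α.val.testBit (j + 1)} : ℝ) := by
    have h1 : (B.length : ℝ) ≤ (Finset.card {j ∈ Finset.range n | 1 ≤ j ∧ j + 2 < n ∧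
        α.val.testBit j ≠ α.val.testBit (j + 1)} : ℝ) + 3 := by
      exact_mod_cast hB.length_le_card_boundaries
    have h2 : 6 ≤ c * n := by
      have := (div_le_iff₀ hc).1 (Nat.ceil_le.1 hnc)
      linarith
    linarith
  obtain ⟨E, hEcard, hE⟩ := hweight α.val n _ (l ^ d) hn1 hα
    (fun j hj => (Finset.mem_filter.1 hj).2) hJ (hN n hNn)
  have hs : C.size * 2 ^ t ≤ 2 ^ l := by
    rw [hl, pow_add]
    gcongr
    have : (C.size : ℝ) ≤ (2 : ℝ) ^ ⌈r⌉₊ := by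
      refine hsize.trans ?_
      rw [← Real.rpow_natCast]
      exact Real.rpow_le_rpow_of_exponent_le (by norm_num) (Nat.le_ceil r)
    exact_mod_cast this
  obtain ⟨β, hβ, hfin⟩ := C.ncard_evalField_eq_pow_le (by omega) hl1 rfl b hC hs E hE
  rw [GaloisField.card 2 n (by omega)]
  have hβ' : (β : ℝ) * 2 ^ t ≤ 2 ^ n := by exact_mod_cast hβ
  have hfin' : (Set.ncard {x : GaloisField 2 n | C.evalField b x = x ^ α.val} : ℝ) + E.card
      ≤ 2 ^ n + β := by exact_mod_cast hfin
  have h2n : (0 : ℝ) < 2 ^ n := by positivity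
  have hβ2 : (β : ℝ) ≤ δ / 2 * 2 ^ n := by
    calc (β : ℝ) = (1 / 2) ^ t * (β * 2 ^ t) := by
          rw [one_div, inv_pow]; field_simp
      _ ≤ (1 / 2) ^ t * 2 ^ n := by gcongr
      _ ≤ δ / 2 * 2 ^ n := by gcongr
  push_cast
  rw [div_le_iff₀ h2n]
  linarith
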